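/- Let $n\ge 1$ and $d>n$ be integers, let $F_1,\dots,F_{d-n}$ be arbitrary real quadratic forms on $\mathbb{R}^n$ (no curvature or non-degeneracy assumption is needed), let $\Omega\subset\mathbb{R}^n$ be an open ball, and let $\mathcal{M}=\{(\xi,F_1(\xi),\dots,F_{d-n}(\xi)):\xi\in\Omega\}\subset\mathbb{R}^d$ be the corresponding $n$-dimensional quadratic manifold. For $f\in C_c^\infty(\Omega)$ (complex valued) put $$\mathcal{E}^{\mathcal{M}}f(x)=\int_\Omega e^{2\pi i\,x\cdot(\xi,F_1(\xi),\dots,F_{d-n}(\xi))}f(\xi)\,d\xi,\qquad x\in\mathbb{R}^d,$$ and for a measurable function $g$ on $\mathbb{R}^d$ let $\|g\|_{L^{q,\infty}(\mathbb{R}^d)}=\sup_{t>0}t\,|\{x:|g(x)|>t\}|^{1/q}$. Then for every $0<p\le\infty$ there is no finite constant $C$ such that $$\|\mathcal{E}^{\mathcal{M}}f\|_{L^{2d/n,\infty}(\mathbb{R}^d)}\le C\,\|f\|_{L^p(\Omega)}\qquad\text{for all } f\in C_c^\infty(\Omega),$$ and $\mathcal{E}^{\mathcal{M}}$ does not extend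 from $C_c^\infty(\Omega)$ to a bounded linear operator $L^p(\Omega)\to L^{2d/n,\infty}(\mathbb{R}^d)$. In particular this holds for every well-curved quadratic manifold $\mathcal{M}$. -/

import Mathlib

open MeasureTheory Metric
open scoped ENNReal NNReal ContDiff

noncomputable section

/-- The graph map `ξ ↦ (ξ, F₁(ξ), …, F_k(ξ))` from `ℝⁿ` to `ℝᵈ`, `d = n + k`. The quadratic
manifold over `Ω` given by the quadratic forms `F₁, …, F_k` is the image of `Ω` under this map. -/
def graphMap {n k : ℕ} (F : Fin k → QuadraticForm ℝ (EuclideanSpace ℝ (Fin n)))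
    (ξ : EuclideanSpace ℝ (Fin n)) : EuclideanSpace ℝ (Fin (n + k)) :=
  WithLp.toLp 2 (Fin.append (fun i => ξ i) (fun j => F j ξ))

/-- The Fourier extension operator
`f ↦ ∫_Ω exp(2πi x · (ξ, F₁(ξ), …, F_k(ξ))) f(ξ) dξ` of the quadratic manifold over `Ω`. -/
def extensionOp {n k : ℕ} (F : Fin k → QuadraticForm ℝ (EuclideanSpace ℝ (Fin n)))
    (Ω : Set (EuclideanSpace ℝ (Fin n))) (f : EuclideanSpace ℝ (Fin n) → ℂ)
    (x : EuclideanSpace ℝ (Fin (n + k))) : ℂ :=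
  ∫ ξ in Ω, Complex.exp (2 * Real.pi * Complex.I * (inner ℝ x (graphMap F ξ) : ℝ)) * f ξ

/-- The quasinorm of `L^{q,∞}(ℝᵈ)`: the supremum over `t` of `t |{x : |g(x)| > t}|^{1/q}`. -/
def weakLpNorm {d : ℕ} (g : EuclideanSpace ℝ (Fin d) → ℂ) (q : ℝ) : ℝ≥0∞ :=
  ⨆ t : ℝ≥0, (t : ℝ≥0∞) * volume {x | (t : ℝ≥0∞) < ‖g x‖ₑ} ^ (1 / q)

/-- `f` is a smooth function whose support is a compact subset of `Ω`. -/
structure IsTestFunction {n : ℕ} (Ω : Set (EuclideanSpace ℝ (Fin n)))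
    (f : EuclideanSpace ℝ (Fin n) → ℂ) : Prop where
  smooth : ContDiff ℝ ∞ f
  compact : HasCompactSupport f
  support : tsupport f ⊆ Ω

/-- The estimate `‖E f‖_{L^{q,∞}(ℝᵈ)} ≤ C ‖f‖_{L^p(Ω)}` holds for all smooth `f` compactly
supported in `Ω`, with a constant `C` independent of `f`. -/
def HasWeakExtensionEstimate {n k : ℕ} (F : Fin k → QuadraticForm ℝ (EuclideanSpace ℝ (Fin n)))
    (Ω : Set (EuclideanSpace ℝ (Fin n))) (p : ℝ≥0∞) (q : ℝ) : Prop :=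
  ∃ C : ℝ≥0, ∀ f : EuclideanSpace ℝ (Fin n) → ℂ, IsTestFunction Ω f →
    weakLpNorm (extensionOp F Ω f) q ≤ C * eLpNorm f p (volume.restrict Ω)

/-- There is a bounded linear operator `T : L^p(Ω) → L^{q,∞}(ℝᵈ)` which agrees with the
extension operator on smooth functions compactly supported in `Ω`. -/
def ExtendsToBoundedOperator {n k : ℕ} (F : Fin k → QuadraticForm ℝ (EuclideanSpace ℝ (Fin n)))
    (Ω : Set (EuclideanSpace ℝ (Fin n))) (p : ℝ≥0∞) (q : ℝ) : Prop :=
  ∃ T : Lp ℂ p (volume.restrict Ω) →ₗ[ℂ] (EuclideanSpace ℝ (Fin (n + k)) →ₘ[volume] ℂ),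
    (∃ C : ℝ≥0, ∀ g : Lp ℂ p (volume.restrict Ω), weakLpNorm (T g) q ≤ C * ‖g‖ₑ) ∧
    ∀ f : EuclideanSpace ℝ (Fin n) → ℂ, IsTestFunction Ω f →
      ∀ g : Lp ℂ p (volume.restrict Ω), g =ᵐ[volume.restrict Ω] f →
        T g =ᵐ[volume] extensionOp F Ω f

end

/-!
The exponent `q = 2 (n + k) / n` is the one at which a single wave packet estimate is scale
invariant, and there the Besicovitch compression phenomenon defeats even a weak type bound.

Cut the ball into caps of radius about `δ` at grid points `ξ_ν`. A bump function on such a cap,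
modulated by `b_ν`, has an extension of size about `δ ^ n` on a plank in `ℝⁿ × ℝᵏ`, namely
`‖t‖ ≤ κ / δ ^ 2`, `‖y - (b_ν - ∇F_t(ξ_ν))‖ ≤ κ / δ` with `F_t = ∑ⱼ tⱼ Fⱼ`; this holds because the
phase hardly varies there (`le_norm_extensionOp_wavePacket`). Only the bilinearity of
`(t, ξ) ↦ ∇F_t(ξ)` matters for the position of the planks, so that no curvature is needed: by
`exists_compression` the translations `b_ν` can be chosen such that the union `E` of the planks has
volume at most `ε` times a constant multiple of `δ ^ (-2 (n + k))`.

Write `𝓔` for the extension operator. With suitable signs, the sum `f` of the wave packets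
satisfies `|f| ≤ 1` and `∫_E |𝓔 f|² ≥ ∑_ν ∫_E |𝓔 f_ν|²`, which is at least a constant times `δ ^ (-2 k)`
(`exists_signs_sum_lintegral_sq_le`). On the other hand, since `q > 2`, a weak type estimate bounds
`∫_E |𝓔 f|²` by a constant times `T² |E| + T ^ (2 - q)` for every height `T`
(`setLIntegral_sq_le_of_distribution`). For `T = τ δ ^ n` this is a constant times
`(τ² ε + τ ^ (2 - q)) δ ^ (-2 k)`. Taking `τ` large and then `ε` small gives a contradiction, for
every `p`, as `‖f‖_p` is bounded by a power of the volume of the ball. An extension to a bounded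
operator on `L^p` would imply the weak type estimate on test functions.
-/

/-! ### Besicovitch compression for a bilinear family -/

/-- The base `L` expansion of `v / L ^ M`; the `l`-th digit, counted from the most significant one,
is `v / L ^ (M - 1 - l) % L`. -/
theorem sum_digits_div (L : ℕ) (hL : 1 ≤ L) (M : ℕ) : ∀ v : ℕ, v < L ^ M →
    ∑ l ∈ Finset.range M, ((v / L ^ (M - 1 - l) % L : ℕ) : ℝ) / (L : ℝ) ^ (l + 1)
      = (v : ℝ) / (L : ℝ) ^ M := by
  induction M with
  | zero => intro v hv; have : v = 0 := by simpa using hv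
            simp [this]
  | succ M ih =>
    intro v hv
    have hL0 : (L : ℝ) ≠ 0 := by positivity
    have h1 : v / L < L ^ M := by
      rw [Nat.div_lt_iff_lt_mul (by omega)]; simpa [pow_succ] using hv
    rw [Finset.sum_range_succ]
    have h2 : ∀ l ∈ Finset.range M,
        ((v / L ^ (M + 1 - 1 - l) % L : ℕ) : ℝ) / (L : ℝ) ^ (l + 1)
          = (((v / L) / L ^ (M - 1 - l) % L : ℕ) : ℝ) / (L : ℝ) ^ (l + 1) := by
      intro l hl
      have hl' := Finset.mem_range.1 hl
      rw [Nat.div_div_eq_div_mul, ← pow_succ', show M + 1 - 1 - l = M - 1 - l + 1 by omega]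
    rw [Finset.sum_congr rfl h2, ih _ h1]
    have h3 : (v : ℝ) = L * ((v / L : ℕ) : ℝ) + ((v % L : ℕ) : ℝ) := by
      exact_mod_cast (Nat.div_add_mod v L).symm
    simp only [Nat.add_sub_cancel, Nat.sub_self, pow_zero, Nat.div_one]
    rw [h3, pow_succ]
    field_simp

theorem sum_Ico_inv_pow_le {L : ℝ} (hL : 2 ≤ L) (m M : ℕ) :
    ∑ l ∈ Finset.Ico m M, (L ^ l)⁻¹ ≤ 2 * (L ^ m)⁻¹ := by
  have hL0 : 0 < L := by linarith
  by_cases h : m ≤ M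
  · suffices ∑ l ∈ Finset.Ico m M, (L ^ l)⁻¹ ≤ 2 * (L ^ m)⁻¹ - 2 * (L ^ M)⁻¹ by
      have : 0 < (L ^ M)⁻¹ := by positivity
      linarith
    induction M, h using Nat.le_induction with
    | base => simp
    | succ M hM ih =>
      rw [Finset.sum_Ico_succ_top hM]
      have : 2 * (L ^ (M + 1))⁻¹ ≤ (L ^ M)⁻¹ := by
        rw [pow_succ, mul_inv]
        have h1 : 2 * L⁻¹ ≤ 1 := by
          rw [← div_eq_mul_inv, div_le_one hL0]; exact hL
        have h2 : 0 < (L ^ M)⁻¹ := by positivity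
        nlinarith
      linarith
  · rw [Finset.Ico_eq_empty (by omega)]
    simp; positivity

theorem exists_seq_cover_closedBall (k : ℕ) {κ : ℝ} (hκ : 0 < κ) {η : ℝ} (hη : 0 < η) :
    ∃ (M : ℕ) (τ : ℕ → Fin k → ℝ), (∀ l, ‖τ l‖ ≤ κ) ∧
      ∀ t, ‖t‖ ≤ κ → ∃ m < M, ‖τ m - t‖ ≤ η := by
  obtain ⟨S, hS, hfin, hcov⟩ :=
    (isCompact_closedBall (0 : Fin k → ℝ) κ).finite_cover_balls hη
  lift S to Finset (Fin k → ℝ) using hfin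
  refine ⟨S.card, fun l => if h : l < S.card then (S.equivFin.symm ⟨l, h⟩ : Fin k → ℝ) else 0,
    fun l => ?_, fun t ht => ?_⟩
  · dsimp only
    split_ifs with h
    · simpa using hS (S.equivFin.symm ⟨l, h⟩).2
    · simpa using hκ.le
  · obtain ⟨y, hy, hty⟩ := Set.mem_iUnion₂.1 (hcov (mem_closedBall_zero_iff.2 ht))
    refine ⟨S.equivFin ⟨y, hy⟩, (S.equivFin ⟨y, hy⟩).2, ?_⟩
    rw [mem_ball, dist_comm, dist_eq_norm] at hty
    simpa using hty.le

/-- The contribution of the `l`-th base `L` digits to the expansion of the vector `v / L ^ m`, where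
the `m` digits of each coordinate `v i < L ^ m` are counted from the most significant one. -/
noncomputable def digitVec {n : ℕ} (L m l : ℕ) (v : Fin n → ℕ) : Fin n → ℝ :=
  fun i => ((v i / L ^ (m - 1 - l) % L : ℕ) : ℝ) / (L : ℝ) ^ (l + 1)

theorem norm_digitVec_le {n L : ℕ} (hL : 1 ≤ L) (m l : ℕ) (v : Fin n → ℕ) :
    ‖digitVec L m l v‖ ≤ ((L : ℝ) ^ l)⁻¹ := by
  have hL0 : (0 : ℝ) < L := by exact_mod_cast hL
  refine (pi_norm_le_iff_of_nonneg (by positivity)).2 fun i => ?_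
  rw [digitVec, Real.norm_of_nonneg (by positivity), div_le_iff₀ (by positivity), pow_succ,
    inv_mul_cancel_left₀ (by positivity)]
  exact_mod_cast (Nat.mod_lt _ (by omega)).le

/-- Deleting the last `M - m` digits does not change the first `m`. -/
theorem digitVec_div {n L M m l : ℕ} (hm : m ≤ M) (hl : l < m) (v : Fin n → ℕ) :
    digitVec L m l (fun i => v i / L ^ (M - m)) = digitVec L M l v := by
  ext i
  simp only [digitVec]
  rw [Nat.div_div_eq_div_mul, ← pow_add, show M - m + (m - 1 - l) = M - 1 - l by omega]

/-- Besicovitch compression: the points `ν / N` of a grid in the unit cube can be assigned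
translations `a ν` such that, for each `t` in a ball, the `κ / N`-neighbourhood of the points
`a ν - A t (ν / N)` is covered by cubes of total volume at most `ε`.

If `τ₀, …, τ_{M-1}` is an `η`-net of the ball, then `a ν` applies `A τₗ` to the `l`-th digit of
`ν / N`, so that `a ν - A t (ν / N)` applies `A (τₗ - t)` to it. When `τₘ` is `η`-close to `t`, the
`m`-th digit contributes only `O(η L⁻ᵐ)`, the later ones `O(L⁻ᵐ⁻¹)`, and there are only `Lᵐⁿ`
possibilities for the earlier ones. -/
theorem exists_compression {n k : ℕ} (hn : 1 ≤ n)
    (A : (Fin k → ℝ) →L[ℝ] (Fin n → ℝ) →L[ℝ] (Fin n → ℝ)) {κ : ℝ} (hκ : 0 < κ)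
    {ε : ℝ} (hε : 0 < ε) :
    ∃ N : ℕ, 1 ≤ N ∧ ∃ a : (Fin n → ℕ) → Fin n → ℝ, ∀ t, ‖t‖ ≤ κ →
      ∃ (P : Finset (Fin n → ℝ)) (ρ : ℝ), 0 ≤ ρ ∧ P.card * (2 * ρ) ^ n ≤ ε ∧
        ∀ ν : Fin n → ℕ, (∀ i, ν i < N) →
          ∃ p ∈ P, ‖a ν - A t (fun i => (ν i : ℝ) / N) - p‖ + κ / N ≤ ρ := by
  set C : ℝ := ‖A‖ + 4 * κ * ‖A‖ + κ with hC
  have hC0 : 0 < C := by positivity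
  obtain ⟨η, hη, hηε⟩ : ∃ η : ℝ, 0 < η ∧ 2 * (η * C) ≤ min ε 1 := by
    refine ⟨min ε 1 / (2 * C), by positivity, le_of_eq ?_⟩
    field_simp
  obtain ⟨M, τ, hτ, hcov⟩ := exists_seq_cover_closedBall k hκ hη
  obtain ⟨L, hL⟩ := exists_nat_ge (max 2 (1 / η))
  have hL2 : (2 : ℝ) ≤ L := (le_max_left _ _).trans hL
  have hL1 : 1 ≤ L := by have : 2 ≤ L := by exact_mod_cast hL2
                         omega
  have hL0 : (0 : ℝ) < L := by linarith
  have hLη : (L : ℝ)⁻¹ ≤ η := by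
    rw [inv_le_comm₀ hL0 hη, ← one_div]; exact (le_max_right _ _).trans hL
  have hsucc : ∀ m : ℕ, ((L : ℝ) ^ (m + 1))⁻¹ ≤ η * ((L : ℝ) ^ m)⁻¹ := fun m => by
    rw [pow_succ, mul_inv, mul_comm]; gcongr
  refine ⟨L ^ M, Nat.one_le_pow _ _ hL1,
    fun ν => ∑ l ∈ Finset.range M, A (τ l) (digitVec L M l ν), fun t ht => ?_⟩
  obtain ⟨m, hm, htm⟩ := hcov t ht
  classical
  -- The part of `a ν - A t (ν / N)` that depends on the first `m` digits only.
  set Q : (Fin n → ℕ) → Fin n → ℝ :=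
    fun w => ∑ l ∈ Finset.range m, A (τ l - t) (digitVec L m l w) with hQ
  refine ⟨(Fintype.piFinset fun _ : Fin n => Finset.range (L ^ m)).image Q,
    η * C * ((L : ℝ) ^ m)⁻¹, by positivity, ?_, fun ν hν => ?_⟩
  · have hcard : ((((Fintype.piFinset fun _ : Fin n => Finset.range (L ^ m)).image Q).card : ℕ) : ℝ)
        ≤ ((L : ℝ) ^ m) ^ n := by
      have := Finset.card_image_le (s := Fintype.piFinset fun _ : Fin n => Finset.range (L ^ m))
        (f := Q)
      rw [Fintype.card_piFinset] at this
      simp only [Finset.card_range, Finset.prod_const, Finset.card_univ, Fintype.card_fin] at this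
      exact_mod_cast this
    calc _ ≤ ((L : ℝ) ^ m) ^ n * (2 * (η * C * ((L : ℝ) ^ m)⁻¹)) ^ n := by gcongr
      _ = (2 * (η * C)) ^ n := by
        rw [← mul_pow]; congr 1; field_simp
      _ ≤ 2 * (η * C) := pow_le_of_le_one (by positivity) (hηε.trans (min_le_right _ _)) (by omega)
      _ ≤ ε := hηε.trans (min_le_left _ _)
  · refine ⟨Q fun i => ν i / L ^ (M - m), Finset.mem_image_of_mem _ ?_, ?_⟩
    · rw [Fintype.mem_piFinset]
      intro i
      rw [Finset.mem_range, Nat.div_lt_iff_lt_mul (by positivity), ← pow_add,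
        show m + (M - m) = M by omega]
      exact hν i
    · have hsum : (fun i => (ν i : ℝ) / ((L ^ M : ℕ) : ℝ))
          = ∑ l ∈ Finset.range M, digitVec L M l ν := by
        ext i
        rw [Finset.sum_apply]
        simp only [digitVec]
        rw [sum_digits_div L hL1 M _ (hν i)]
        push_cast; rfl
      have hQν : Q (fun i => ν i / L ^ (M - m))
          = ∑ l ∈ Finset.range m, A (τ l - t) (digitVec L M l ν) :=
        Finset.sum_congr rfl fun l hl => by
          rw [digitVec_div hm.le (Finset.mem_range.1 hl)]
      have hdiff : (∑ l ∈ Finset.range M, A (τ l) (digitVec L M l ν))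
            - A t (fun i => (ν i : ℝ) / ((L ^ M : ℕ) : ℝ)) - Q (fun i => ν i / L ^ (M - m))
          = A (τ m - t) (digitVec L M m ν)
            + ∑ l ∈ Finset.Ico (m + 1) M, A (τ l - t) (digitVec L M l ν) := by
        rw [hsum, hQν, map_sum, ← Finset.sum_sub_distrib]
        simp_rw [← sub_apply, ← map_sub]
        rw [← Finset.sum_range_add_sum_Ico _ hm.le, add_sub_cancel_left,
          Finset.sum_eq_sum_Ico_succ_bot hm]
      have hterm : ∀ l, ‖A (τ l - t) (digitVec L M l ν)‖
          ≤ ‖A‖ * ‖τ l - t‖ * ((L : ℝ) ^ l)⁻¹ := fun l =>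
        (A.le_opNorm₂ _ _).trans (by gcongr; exact norm_digitVec_le hL1 _ _ _)
      have h2κ : ∀ l, ‖τ l - t‖ ≤ 2 * κ := fun l =>
        (norm_sub_le _ _).trans (by linarith [hτ l])
      have hA := norm_nonneg A
      have htail : ‖∑ l ∈ Finset.Ico (m + 1) M, A (τ l - t) (digitVec L M l ν)‖
          ≤ 4 * κ * ‖A‖ * (η * ((L : ℝ) ^ m)⁻¹) := by
        calc _ ≤ ∑ l ∈ Finset.Ico (m + 1) M, ‖A‖ * (2 * κ) * ((L : ℝ) ^ l)⁻¹ :=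
              norm_sum_le_of_le _ fun l _ => (hterm l).trans (by gcongr; exact h2κ l)
          _ = ‖A‖ * (2 * κ) * ∑ l ∈ Finset.Ico (m + 1) M, ((L : ℝ) ^ l)⁻¹ := by
              rw [Finset.mul_sum]
          _ ≤ ‖A‖ * (2 * κ) * (2 * (η * ((L : ℝ) ^ m)⁻¹)) := by
              gcongr
              exact (sum_Ico_inv_pow_le hL2 _ _).trans (by gcongr; exact hsucc m)
          _ = _ := by ring
      have hhead : ‖A (τ m - t) (digitVec L M m ν)‖ ≤ ‖A‖ * η * ((L : ℝ) ^ m)⁻¹ :=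
        (hterm m).trans (by gcongr)
      have hlast : κ / ((L ^ M : ℕ) : ℝ) ≤ κ * (η * ((L : ℝ) ^ m)⁻¹) := by
        rw [div_eq_mul_inv]
        push_cast
        gcongr
        refine le_trans ?_ (hsucc m)
        gcongr
        · linarith
        · omega
      rw [hdiff]
      calc _ ≤ ‖A‖ * η * ((L : ℝ) ^ m)⁻¹ + 4 * κ * ‖A‖ * (η * ((L : ℝ) ^ m)⁻¹)
            + κ * (η * ((L : ℝ) ^ m)⁻¹) :=
            add_le_add ((norm_add_le _ _).trans (add_le_add hhead htail)) hlast
        _ = _ := by rw [hC]; ring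

/-! ### Weak type bounds and square functions -/

/-- Chebyshev's form of a bound on the weak `L^q` quasinorm. -/
theorem volume_norm_gt_le {d : ℕ} {g : EuclideanSpace ℝ (Fin d) → ℂ} {q : ℝ} (hq : 0 < q)
    {K : ℝ≥0∞} (hK : weakLpNorm g q ≤ K) {t : ℝ} (ht : 0 < t) :
    volume {x | t < ‖g x‖} ≤ K ^ q * ENNReal.ofReal (t ^ (-q)) := by
  lift t to ℝ≥0 using ht.le
  have h1 : (t : ℝ≥0∞) * volume {x | (t : ℝ≥0∞) < ‖g x‖ₑ} ^ (1 / q) ≤ K :=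
    (le_iSup (fun t : ℝ≥0 => (t : ℝ≥0∞) * volume {x | (t : ℝ≥0∞) < ‖g x‖ₑ} ^ (1 / q)) t).trans hK
  have hset : {x | (t : ℝ≥0∞) < ‖g x‖ₑ} = {x | (t : ℝ) < ‖g x‖} := by
    ext x
    simp only [Set.mem_ofPred_eq, enorm_eq_nnnorm, ENNReal.coe_lt_coe]
    exact NNReal.coe_lt_coe.symm
  rw [hset] at h1
  have ht0 : (t : ℝ≥0∞) ≠ 0 := by
    have : (t : ℝ≥0) ≠ 0 := by rintro rfl; simp at ht
    exact_mod_cast this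
  have h2 := ENNReal.rpow_le_rpow h1 hq.le
  rw [ENNReal.mul_rpow_of_nonneg _ _ hq.le, ← ENNReal.rpow_mul, one_div_mul_cancel hq.ne',
    ENNReal.rpow_one] at h2
  have h3 : ENNReal.ofReal ((t : ℝ) ^ (-q)) = ((t : ℝ≥0∞) ^ q)⁻¹ := by
    rw [← ENNReal.ofReal_rpow_of_pos ht, ENNReal.ofReal_coe_nnreal, ENNReal.rpow_neg]
  rw [h3, ← div_eq_mul_inv, ENNReal.le_div_iff_mul_le, mul_comm]
  · exact h2
  · left; simp [ENNReal.rpow_eq_zero_iff, ht0]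
  · left; exact ENNReal.rpow_ne_top_of_nonneg hq.le ENNReal.coe_ne_top

/-- A function in weak `L^q` with `q > 2` is locally square integrable: on `E`, its square is at most
`T ^ 2` where the function is below `T`, and the decay of the distribution function controls the
rest. -/
theorem setLIntegral_sq_le_of_distribution {α : Type*} [MeasurableSpace α] (μ : Measure α)
    {h : α → ℝ} (h0 : ∀ x, 0 ≤ h x) (hm : AEMeasurable h μ) {q : ℝ} (hq : 2 < q) {B : ℝ≥0∞}
    (hB : ∀ t : ℝ, 0 < t → μ {x | t < h x} ≤ B * ENNReal.ofReal (t ^ (-q)))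
    (E : Set α) {T : ℝ} (hT : 0 < T) :
    ∫⁻ x in E, ENNReal.ofReal (h x ^ 2) ∂μ
      ≤ 2 * (ENNReal.ofReal (T ^ 2) * μ E + B * ENNReal.ofReal (T ^ (2 - q) / (q - 2))) := by
  have h1 := lintegral_rpow_eq_lintegral_meas_lt_mul (μ.restrict E)
    (Filter.Eventually.of_forall h0) hm.restrict (p := 2) two_pos
  simp only [Real.rpow_two] at h1
  rw [h1, show ENNReal.ofReal 2 = 2 by simp]
  gcongr
  rw [show Set.Ioi (0 : ℝ) = Set.Ioc 0 T ∪ Set.Ioi T from (Set.Ioc_union_Ioi_eq_Ioi hT.le).symm]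
  refine (lintegral_union_le _ _ _).trans (add_le_add ?_ ?_)
  · calc _ ≤ ∫⁻ t in Set.Ioc 0 T, μ E * ENNReal.ofReal T := by
          refine setLIntegral_mono measurable_const fun t ht => ?_
          refine mul_le_mul' ((measure_mono (Set.subset_univ _)).trans (by simp)) ?_
          norm_num
          exact ENNReal.ofReal_le_ofReal ht.2
      _ = _ := by
          rw [setLIntegral_const, Real.volume_Ioc, sub_zero, mul_assoc, ← ENNReal.ofReal_mul hT.le,
            mul_comm, sq]
  · calc _ ≤ ∫⁻ t in Set.Ioi T, B * ENNReal.ofReal (t ^ (1 - q)) := by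
          refine setLIntegral_mono (by fun_prop) fun t ht => ?_
          have ht0 : 0 < t := hT.trans ht
          calc _ ≤ (B * ENNReal.ofReal (t ^ (-q))) * ENNReal.ofReal (t ^ (2 - 1 : ℝ)) := by
                gcongr
                exact (Measure.restrict_apply_le _ _).trans (hB t ht0)
            _ = _ := by
                rw [mul_assoc, ← ENNReal.ofReal_mul (by positivity), ← Real.rpow_add ht0]
                ring_nf
      _ = B * ∫⁻ t in Set.Ioi T, ENNReal.ofReal (t ^ (1 - q)) :=
          lintegral_const_mul _ (by fun_prop)
      _ = _ := by
          rw [← ofReal_integral_eq_lintegral_ofReal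
            (integrableOn_Ioi_rpow_of_lt (by linarith) hT)
            ((ae_restrict_iff' measurableSet_Ioi).2 (Filter.Eventually.of_forall fun t ht =>
              Real.rpow_nonneg (hT.trans ht).le _)),
            integral_Ioi_rpow_of_lt (by linarith) hT]
          congr 2
          rw [show 1 - q + 1 = 2 - q by ring, ← neg_sub q 2]
          field_simp

theorem lintegral_sq_add_add_lintegral_sq_sub {α : Type*} [MeasurableSpace α] {μ : Measure α}
    {u v : α → ℂ} (hu : AEMeasurable u μ) (hv : AEMeasurable v μ) :
    ∫⁻ x, ENNReal.ofReal (‖u x + v x‖ ^ 2) ∂μ + ∫⁻ x, ENNReal.ofReal (‖u x - v x‖ ^ 2) ∂μ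
      = 2 * (∫⁻ x, ENNReal.ofReal (‖u x‖ ^ 2) ∂μ + ∫⁻ x, ENNReal.ofReal (‖v x‖ ^ 2) ∂μ) := by
  rw [← lintegral_add_left' (by fun_prop), ← lintegral_add_left' (by fun_prop),
    ← lintegral_const_mul'' _ (by fun_prop)]
  refine lintegral_congr fun x => ?_
  rw [← ENNReal.ofReal_add (by positivity) (by positivity),
    ← ENNReal.ofReal_add (by positivity) (by positivity),
    show (2 : ℝ≥0∞) = ENNReal.ofReal 2 by simp, ← ENNReal.ofReal_mul (by positivity)]
  congr 1
  have := parallelogram_law_with_norm ℝ (u x) (v x)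
  simp only [sq]; linarith

/-- A deterministic substitute for random signs: adding one function at a time, the parallelogram law
shows that one of the two choices of sign keeps the square function inequality. -/
theorem exists_signs_sum_lintegral_sq_le {α ι : Type*} [MeasurableSpace α] {μ : Measure α}
    [DecidableEq ι] {g : ι → α → ℂ} (hg : ∀ j, AEMeasurable (g j) μ) (s : Finset ι) :
    ∃ σ : ι → ℝ, (∀ j, |σ j| = 1) ∧ ∑ j ∈ s, ∫⁻ x, ENNReal.ofReal (‖g j x‖ ^ 2) ∂μ
      ≤ ∫⁻ x, ENNReal.ofReal (‖∑ j ∈ s, (σ j : ℂ) * g j x‖ ^ 2) ∂μ := by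
  induction s using Finset.induction_on with
  | empty => exact ⟨fun _ => 1, by simp, by simp⟩
  | insert i s hi ih =>
    obtain ⟨σ, hσ, hle⟩ := ih
    set u : α → ℂ := fun x => ∑ j ∈ s, (σ j : ℂ) * g j x with hu
    have hum : AEMeasurable u μ := by
      refine Finset.aemeasurable_fun_sum _ fun j _ => (hg j).const_mul _
    have hpar := lintegral_sq_add_add_lintegral_sq_sub hum (hg i)
    have hupd : ∀ c : ℝ, ∀ x, ∑ j ∈ insert i s, ((Function.update σ i c j : ℝ) : ℂ) * g j x
        = u x + c * g i x := fun c x => by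
      rw [Finset.sum_insert hi, Function.update_self, add_comm]
      congr 1
      refine Finset.sum_congr rfl fun j hj => ?_
      rw [Function.update_of_ne (ne_of_mem_of_not_mem hj hi)]
    have key : ∃ c : ℝ, |c| = 1 ∧ ∫⁻ x, ENNReal.ofReal (‖u x‖ ^ 2) ∂μ
        + ∫⁻ x, ENNReal.ofReal (‖g i x‖ ^ 2) ∂μ
        ≤ ∫⁻ x, ENNReal.ofReal (‖u x + c * g i x‖ ^ 2) ∂μ := by
      by_contra! hcon
      have h1 := hcon 1 (by simp)
      have h2 := hcon (-1) (by simp)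
      simp only [Complex.ofReal_one, Complex.ofReal_neg, one_mul, neg_mul, ← sub_eq_add_neg]
        at h1 h2
      have := ENNReal.add_lt_add h1 h2
      rw [hpar, two_mul] at this
      exact lt_irrefl _ this
    obtain ⟨c, hc, hcle⟩ := key
    refine ⟨Function.update σ i c, fun j => ?_, ?_⟩
    · by_cases h : j = i
      · subst h; simpa using hc
      · rw [Function.update_of_ne h]; exact hσ j
    · simp only [hupd]
      rw [Finset.sum_insert hi, add_comm]
      exact (add_le_add_left hle _).trans hcle

/-! ### The phase on planks -/

/-- The point `(y, t)` of `ℝⁿ⁺ᵏ`, with the `k` variables `t` dual to the quadratic forms listed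
first, so that sections at fixed `t` are those of `Measure.prod_apply`. -/
noncomputable def splitPoint {n k : ℕ} (z : (Fin k → ℝ) × (Fin n → ℝ)) :
    EuclideanSpace ℝ (Fin (n + k)) :=
  WithLp.toLp 2 (Fin.append z.2 z.1)

theorem measurePreserving_splitPoint (n k : ℕ) :
    MeasurePreserving (splitPoint : (Fin k → ℝ) × (Fin n → ℝ) → _) volume volume := by
  have h1 : MeasurePreserving (Prod.swap : (Fin k → ℝ) × (Fin n → ℝ) → _) volume volume :=
    Measure.measurePreserving_swap
  have h2 := volume_measurePreserving_sumPiEquivProdPi_symm (fun _ : Fin n ⊕ Fin k => ℝ)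
  have h3 := volume_measurePreserving_piCongrLeft (fun _ : Fin (n + k) => ℝ)
    (finSumFinEquiv : Fin n ⊕ Fin k ≃ Fin (n + k))
  have h4 := (EuclideanSpace.volume_preserving_symm_measurableEquiv_toLp (Fin (n + k))).symm
  have h := h4.comp (h3.comp (h2.comp h1))
  suffices heq : splitPoint = _ from heq ▸ h
  refine funext fun z => PiLp.ext fun i => ?_
  simp only [splitPoint, Function.comp]
  refine Fin.addCases (fun i => ?_) (fun i => ?_) i
  · have := MeasurableEquiv.piCongrLeft_apply_apply (finSumFinEquiv : Fin n ⊕ Fin k ≃ Fin (n + k))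
      (β := fun _ => ℝ) ((MeasurableEquiv.sumPiEquivProdPi fun _ : Fin n ⊕ Fin k => ℝ).symm z.swap)
      (Sum.inl i)
    rw [finSumFinEquiv_apply_left] at this
    exact (Fin.append_left z.2 z.1 i).trans this.symm
  · have := MeasurableEquiv.piCongrLeft_apply_apply (finSumFinEquiv : Fin n ⊕ Fin k ≃ Fin (n + k))
      (β := fun _ => ℝ) ((MeasurableEquiv.sumPiEquivProdPi fun _ : Fin n ⊕ Fin k => ℝ).symm z.swap)
      (Sum.inr i)
    rw [finSumFinEquiv_apply_right] at this
    exact (Fin.append_right z.2 z.1 i).trans this.symm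

theorem inner_splitPoint_graphMap {n k : ℕ}
    (F : Fin k → QuadraticForm ℝ (EuclideanSpace ℝ (Fin n)))
    (z : (Fin k → ℝ) × (Fin n → ℝ)) (ξ : EuclideanSpace ℝ (Fin n)) :
    inner ℝ (splitPoint z) (graphMap F ξ) = ∑ i, z.2 i * ξ i + ∑ j, z.1 j * F j ξ := by
  simp only [splitPoint, graphMap, PiLp.inner_apply, Fin.sum_univ_add, Fin.append_left,
    Fin.append_right, RCLike.inner_apply, conj_trivial]
  simp only [mul_comm]

/-- The bilinear map `(t, v) ↦ ∇(∑ⱼ tⱼ Fⱼ)(v)`, the gradient being written in coordinates. -/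
noncomputable def gradBilin {n k : ℕ} (F : Fin k → QuadraticForm ℝ (EuclideanSpace ℝ (Fin n))) :
    (Fin k → ℝ) →L[ℝ] (Fin n → ℝ) →L[ℝ] (Fin n → ℝ) :=
  LinearMap.toContinuousBilinearMap <| LinearMap.mk₂ ℝ
    (fun t v i => ∑ j, t j * QuadraticMap.polarBilin (F j) (WithLp.toLp 2 v)
      (EuclideanSpace.single i 1))
    (fun t t' v => by ext i; simp [add_mul, Finset.sum_add_distrib])
    (fun c t v => by ext i; simp [mul_assoc, Finset.mul_sum])
    (fun t v v' => by
      ext i; simp only [WithLp.toLp_add, map_add, LinearMap.add_apply, mul_add,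
        Finset.sum_add_distrib, Pi.add_apply])
    (fun c t v => by
      ext i; simp only [WithLp.toLp_smul, map_smul, LinearMap.smul_apply, smul_eq_mul,
        Pi.smul_apply, Finset.mul_sum, mul_left_comm])

theorem eq_sum_smul_single {n : ℕ} (η : EuclideanSpace ℝ (Fin n)) :
    η = ∑ i, η i • EuclideanSpace.single i (1 : ℝ) := by
  ext l
  simp [Finset.sum_apply, Pi.single_apply]

theorem sum_mul_polar_eq {n k : ℕ} (F : Fin k → QuadraticForm ℝ (EuclideanSpace ℝ (Fin n)))
    (t : Fin k → ℝ) (v : Fin n → ℝ) (η : EuclideanSpace ℝ (Fin n)) :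
    ∑ j, t j * QuadraticMap.polar (F j) (WithLp.toLp 2 v) η = ∑ i, gradBilin F t v i * η i := by
  have h : ∀ j, QuadraticMap.polar (F j) (WithLp.toLp 2 v) η
      = ∑ i, QuadraticMap.polarBilin (F j) (WithLp.toLp 2 v) (EuclideanSpace.single i 1) * η i := by
    intro j
    rw [← QuadraticMap.polarBilin_apply_apply]
    conv_lhs => rw [eq_sum_smul_single η]
    simp only [map_sum, map_smul, smul_eq_mul, mul_comm]
  simp only [h, gradBilin, LinearMap.toContinuousBilinearMap_apply, LinearMap.mk₂_apply,
    Finset.mul_sum, Finset.sum_mul]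
  rw [Finset.sum_comm]
  simp only [mul_assoc]

theorem exists_quadraticForm_bound {n k : ℕ}
    (F : Fin k → QuadraticForm ℝ (EuclideanSpace ℝ (Fin n))) :
    ∃ C : ℝ, 0 ≤ C ∧ ∀ j ξ, |F j ξ| ≤ C * ‖ξ‖ ^ 2 := by
  set β : Fin k → EuclideanSpace ℝ (Fin n) →L[ℝ] EuclideanSpace ℝ (Fin n) →L[ℝ] ℝ :=
    fun j => LinearMap.toContinuousBilinearMap (QuadraticMap.polarBilin (F j)) with hβ
  refine ⟨∑ j, ‖β j‖, by positivity, fun j ξ => ?_⟩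
  have h1 : β j ξ ξ = 2 * F j ξ := by
    simp [hβ, QuadraticMap.polar_self]
  have h2 := (β j).le_opNorm₂ ξ ξ
  have h3 : ‖β j‖ ≤ ∑ j, ‖β j‖ :=
    Finset.single_le_sum (f := fun j => ‖β j‖) (fun j _ => (norm_nonneg (β j) : _)) (Finset.mem_univ j)
  rw [h1, Real.norm_eq_abs, abs_mul, abs_two] at h2
  nlinarith [abs_nonneg (F j ξ), sq_nonneg ‖ξ‖]

/-- At the scale `κ`, a plank `‖t‖ ≤ κ / δ ^ 2`, `‖y - (b - ∇F_t(v))‖ ≤ κ / δ` is so small that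
the phase of the wave packet of frequency `v`, width `δ` and position `b` varies by at most `1 / 8`
over the cap of radius `δ` at `v`. -/
def IsPlankConstant {n k : ℕ} (F : Fin k → QuadraticForm ℝ (EuclideanSpace ℝ (Fin n)))
    (κ : ℝ) : Prop :=
  ∀ (δ : ℝ), 0 < δ → ∀ (t : Fin k → ℝ) (y b v : Fin n → ℝ)
    (ξ : EuclideanSpace ℝ (Fin n)), ‖t‖ ≤ κ / δ ^ 2 →
    ‖y - (b - gradBilin F t v)‖ ≤ κ / δ → ‖ξ - WithLp.toLp 2 v‖ ≤ δ →
    |(∑ i, (y i - b i) * ξ i + ∑ j, t j * F j ξ)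
      - (∑ i, (y i - b i) * v i + ∑ j, t j * F j (WithLp.toLp 2 v))| ≤ 1 / 8

theorem exists_isPlankConstant {n k : ℕ} (hn : 1 ≤ n)
    (F : Fin k → QuadraticForm ℝ (EuclideanSpace ℝ (Fin n))) :
    ∃ κ : ℝ, 0 < κ ∧ IsPlankConstant F κ := by
  obtain ⟨C, hC, hF⟩ := exists_quadraticForm_bound F
  have hn0 : (0 : ℝ) < n := by exact_mod_cast hn
  have hden : 0 < n + k * C := by positivity
  refine ⟨1 / (8 * (n + k * C)), by positivity, fun δ hδ t y b v ξ ht hy hξ => ?_⟩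
  set κ := 1 / (8 * (n + k * C)) with hκ
  have hκ0 : 0 < κ := by positivity
  obtain ⟨η, rfl⟩ : ∃ η, ξ = WithLp.toLp 2 v + η := ⟨ξ - WithLp.toLp 2 v, by abel⟩
  rw [add_sub_cancel_left] at hξ
  have hexp : ∀ j, F j (WithLp.toLp 2 v + η)
      = F j (WithLp.toLp 2 v) + QuadraticMap.polar (F j) (WithLp.toLp 2 v) η + F j η := by
    intro j; rw [QuadraticMap.map_add (F j)]; ring
  have hpol := sum_mul_polar_eq F t v η
  have heq : (∑ i, (y i - b i) * (WithLp.toLp 2 v + η) i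
        + ∑ j, t j * F j (WithLp.toLp 2 v + η))
        - (∑ i, (y i - b i) * v i + ∑ j, t j * F j (WithLp.toLp 2 v))
      = ∑ i, (y - (b - gradBilin F t v)) i * η i + ∑ j, t j * F j η := by
    simp only [hexp, PiLp.add_apply, mul_add, Finset.sum_add_distrib, hpol, Pi.sub_apply,
      sub_mul, sub_sub_eq_add_sub, Finset.sum_sub_distrib]
    simp only [add_mul, Finset.sum_add_distrib]
    ring
  rw [heq]
  have h1 : |∑ i, (y - (b - gradBilin F t v)) i * η i| ≤ n * κ := by
    calc _ ≤ ∑ i, |(y - (b - gradBilin F t v)) i * η i| := Finset.abs_sum_le_sum_abs _ _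
      _ ≤ ∑ _i : Fin n, κ := Finset.sum_le_sum fun i _ => by
          rw [abs_mul]
          calc _ ≤ κ / δ * δ := by
                gcongr
                · exact (norm_le_pi_norm (y - (b - gradBilin F t v)) i).trans hy
                · exact (PiLp.norm_apply_le η i).trans hξ
            _ = κ := by field_simp
      _ = n * κ := by simp
  have h2 : |∑ j, t j * F j η| ≤ k * (C * κ) := by
    calc _ ≤ ∑ j, |t j * F j η| := Finset.abs_sum_le_sum_abs _ _
      _ ≤ ∑ _j : Fin k, C * κ := Finset.sum_le_sum fun j _ => by
          rw [abs_mul]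
          calc _ ≤ κ / δ ^ 2 * (C * δ ^ 2) := by
                gcongr
                · exact (norm_le_pi_norm t j).trans ht
                · exact (hF j η).trans (by gcongr)
            _ = C * κ := by field_simp
      _ = k * (C * κ) := by simp
  refine (abs_add_le _ _).trans ((add_le_add h1 h2).trans (le_of_eq ?_))
  rw [hκ]; field_simp

theorem norm_exp_two_pi_I_mul (s : ℝ) :
    ‖Complex.exp (2 * Real.pi * Complex.I * (s : ℝ))‖ = 1 := by
  rw [show (2 * Real.pi * Complex.I * (s : ℝ) : ℂ) = ((2 * Real.pi * s : ℝ) : ℂ) * Complex.I by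
    push_cast; ring]
  exact Complex.norm_exp_ofReal_mul_I _

/-- No cancellation occurs in an oscillatory integral whose phase stays within `1 / 8` of a constant
on the support of the amplitude. -/
theorem half_integral_le_norm_integral_exp {α : Type*} [MeasurableSpace α] {μ : Measure α}
    {θ φ : α → ℝ} (hθ : Measurable θ) (hφ : Integrable φ μ) (hφ0 : ∀ x, 0 ≤ φ x) (θ₀ : ℝ)
    (h : ∀ x, φ x ≠ 0 → |θ x - θ₀| ≤ 1 / 8) :
    (1 / 2) * ∫ x, φ x ∂μ
      ≤ ‖∫ x, Complex.exp (2 * Real.pi * Complex.I * (θ x : ℝ)) * (φ x : ℂ) ∂μ‖ := by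
  have hint : Integrable
      (fun x => Complex.exp (2 * Real.pi * Complex.I * ((θ x - θ₀ : ℝ) : ℝ)) * (φ x : ℂ)) μ := by
    refine hφ.ofReal.bdd_mul (c := 1) ?_ (Filter.Eventually.of_forall fun x => (norm_exp_two_pi_I_mul _).le)
    exact Measurable.aestronglyMeasurable (by fun_prop)
  have hrot : ∫ x, Complex.exp (2 * Real.pi * Complex.I * ((θ x - θ₀ : ℝ) : ℝ)) * (φ x : ℂ) ∂μ
      = Complex.exp (2 * Real.pi * Complex.I * ((-θ₀ : ℝ) : ℝ))
        * ∫ x, Complex.exp (2 * Real.pi * Complex.I * (θ x : ℝ)) * (φ x : ℂ) ∂μ := by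
    rw [← integral_const_mul]
    congr 1; ext x
    rw [← mul_assoc, ← Complex.exp_add]
    push_cast; ring_nf
  have hnorm := congrArg norm hrot
  rw [norm_mul, norm_exp_two_pi_I_mul, one_mul] at hnorm
  rw [← hnorm]
  refine le_trans ?_ (Complex.re_le_norm _)
  rw [← RCLike.re_eq_complex_re, ← integral_re hint, ← integral_const_mul]
  refine integral_mono (hφ.const_mul _) hint.re fun x => ?_
  have hre : RCLike.re (Complex.exp (2 * Real.pi * Complex.I * ((θ x - θ₀ : ℝ) : ℝ)) * (φ x : ℂ))
      = Real.cos (2 * Real.pi * (θ x - θ₀)) * φ x := by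
    rw [show (2 * Real.pi * Complex.I * ((θ x - θ₀ : ℝ) : ℝ) : ℂ)
      = ((2 * Real.pi * (θ x - θ₀) : ℝ) : ℂ) * Complex.I by push_cast; ring]
    rw [RCLike.re_eq_complex_re, Complex.re_mul_ofReal, Complex.exp_ofReal_mul_I_re]
  simp only [hre]
  by_cases hx : φ x = 0
  · simp [hx]
  · -- `2π / 8 ≤ 1`, and `cos s ≥ 1 - s ^ 2 / 2 ≥ 1 / 2` for `|s| ≤ 1`.
    refine mul_le_mul_of_nonneg_right ?_ (hφ0 x)
    refine le_trans ?_ (Real.one_sub_sq_div_two_le_cos)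
    have h1 : |2 * Real.pi * (θ x - θ₀)| ≤ 1 := by
      rw [abs_mul, abs_of_pos (by positivity)]
      have := h x hx
      nlinarith [Real.pi_lt_four, Real.pi_pos]
    have := (sq_le_one_iff_abs_le_one _).2 h1
    linarith

/-! ### Wave packets and their extensions -/

section
variable {n k : ℕ} (F : Fin k → QuadraticForm ℝ (EuclideanSpace ℝ (Fin n)))

theorem continuous_quadraticForm (Q : QuadraticForm ℝ (EuclideanSpace ℝ (Fin n))) :
    Continuous Q := by
  have h : ∀ ξ, Q ξ = 2⁻¹ * LinearMap.toContinuousBilinearMap (QuadraticMap.polarBilin Q) ξ ξ :=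
    fun ξ => by simp [QuadraticMap.polar_self]
  rw [show (Q : EuclideanSpace ℝ (Fin n) → ℝ) = _ from funext h]
  fun_prop

theorem continuous_graphMap : Continuous (graphMap F) := by
  refine (PiLp.continuous_toLp 2 _).comp (continuous_pi fun i => ?_)
  refine Fin.addCases (fun i => ?_) (fun i => ?_) i
  · simp only [Fin.append_left]; fun_prop
  · simp only [Fin.append_right]; exact continuous_quadraticForm _

theorem measurable_extensionOp (Ω : Set (EuclideanSpace ℝ (Fin n)))
    {f : EuclideanSpace ℝ (Fin n) → ℂ} (hf : Continuous f) : Measurable (extensionOp F Ω f) := by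
  have hg := continuous_graphMap F
  refine StronglyMeasurable.measurable (StronglyMeasurable.integral_prod_right
    (f := fun x ξ => Complex.exp (2 * Real.pi * Complex.I * (inner ℝ x (graphMap F ξ) : ℝ)) * f ξ)
    (Continuous.stronglyMeasurable ?_))
  unfold Function.uncurry
  fun_prop

theorem integrable_extensionOp_integrand (Ω : Set (EuclideanSpace ℝ (Fin n)))
    {f : EuclideanSpace ℝ (Fin n) → ℂ} (hf : Continuous f) (hc : HasCompactSupport f)
    (x : EuclideanSpace ℝ (Fin (n + k))) :
    Integrable (fun ξ => Complex.exp (2 * Real.pi * Complex.I * (inner ℝ x (graphMap F ξ) : ℝ))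
      * f ξ) (volume.restrict Ω) := by
  have hg := continuous_graphMap F
  refine (hf.integrable_of_hasCompactSupport hc).restrict.bdd_mul (c := 1) ?_
    (Filter.Eventually.of_forall fun ξ => (norm_exp_two_pi_I_mul _).le)
  exact Continuous.aestronglyMeasurable (by fun_prop)

theorem extensionOp_sum {ι : Type*} (s : Finset ι) (Ω : Set (EuclideanSpace ℝ (Fin n)))
    {f : ι → EuclideanSpace ℝ (Fin n) → ℂ} (hf : ∀ j, Continuous (f j))
    (hc : ∀ j, HasCompactSupport (f j)) (σ : ι → ℝ) (x : EuclideanSpace ℝ (Fin (n + k))) :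
    extensionOp F Ω (fun ξ => ∑ j ∈ s, (σ j : ℂ) * f j ξ) x
      = ∑ j ∈ s, (σ j : ℂ) * extensionOp F Ω (f j) x := by
  simp only [extensionOp, Finset.mul_sum]
  rw [integral_finsetSum]
  · refine Finset.sum_congr rfl fun j _ => ?_
    rw [← integral_const_mul]
    congr 1; ext ξ; ring
  · intro j _
    refine ((integrable_extensionOp_integrand F Ω (hf j) (hc j) x).const_mul (σ j : ℂ)).congr
      (Filter.Eventually.of_forall fun ξ => ?_)
    simp only; ring

theorem isTestFunction_sum {ι : Type*} (s : Finset ι) {Ω : Set (EuclideanSpace ℝ (Fin n))}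
    {f : ι → EuclideanSpace ℝ (Fin n) → ℂ} (hf : ∀ j, IsTestFunction Ω (f j)) (σ : ι → ℝ) :
    IsTestFunction Ω (fun ξ => ∑ j ∈ s, (σ j : ℂ) * f j ξ) := by
  have hsub : Function.support (fun ξ => ∑ j ∈ s, (σ j : ℂ) * f j ξ)
      ⊆ ⋃ j ∈ s, tsupport (f j) := by
    intro ξ hξ
    obtain ⟨j, hj, hne⟩ := Finset.exists_ne_zero_of_sum_ne_zero hξ
    exact Set.mem_iUnion₂.2 ⟨j, hj, subset_tsupport _ (right_ne_zero_of_mul hne)⟩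
  have hcomp : IsCompact (⋃ j ∈ s, tsupport (f j)) :=
    s.isCompact_biUnion fun j _ => (hf j).compact
  refine ⟨?_, HasCompactSupport.of_support_subset_isCompact hcomp hsub, ?_⟩
  · exact ContDiff.sum fun j _ => contDiff_const.mul (hf j).smooth
  · exact (closure_minimal hsub hcomp.isClosed).trans
      (Set.iUnion₂_subset fun j _ => (hf j).support)

/-- The smooth bump function of the cap of radius `δ / 3` at `v`, equal to `1` within `δ / 4`. -/
noncomputable def capBump (v : Fin n → ℝ) (δ : ℝ) (hδ : 0 < δ) :
    ContDiffBump (WithLp.toLp 2 v : EuclideanSpace ℝ (Fin n)) :=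
  ⟨δ / 4, δ / 3, by positivity, by linarith⟩

/-- A bump function on the cap of radius `δ / 3` at `v`, modulated so that its extension is
translated by `b` in the first `n` variables. -/
noncomputable def wavePacket (v : Fin n → ℝ) (δ : ℝ) (hδ : 0 < δ) (b : Fin n → ℝ)
    (ξ : EuclideanSpace ℝ (Fin n)) : ℂ :=
  Complex.exp (2 * Real.pi * Complex.I * ((-∑ i, b i * ξ i : ℝ) : ℝ)) * (capBump v δ hδ ξ : ℝ)

variable (v : Fin n → ℝ) {δ : ℝ} (hδ : 0 < δ) (b : Fin n → ℝ)

theorem norm_wavePacket_le (ξ : EuclideanSpace ℝ (Fin n)) : ‖wavePacket v δ hδ b ξ‖ ≤ 1 := by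
  rw [wavePacket, norm_mul, norm_exp_two_pi_I_mul, one_mul, Complex.norm_real,
    Real.norm_of_nonneg (capBump v δ hδ).nonneg]
  exact (capBump v δ hδ).le_one

theorem dist_lt_of_wavePacket_ne_zero {ξ : EuclideanSpace ℝ (Fin n)}
    (h : wavePacket v δ hδ b ξ ≠ 0) : dist ξ (WithLp.toLp 2 v) < δ / 3 := by
  by_contra! hcon
  refine h ?_
  rw [wavePacket, (capBump v δ hδ).zero_of_le_dist hcon]
  simp

theorem isTestFunction_wavePacket {Ω : Set (EuclideanSpace ℝ (Fin n))}
    (hΩ : closedBall (WithLp.toLp 2 v) (δ / 3) ⊆ Ω) :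
    IsTestFunction Ω (wavePacket v δ hδ b) := by
  have hsub : Function.support (wavePacket v δ hδ b) ⊆ closedBall (WithLp.toLp 2 v) (δ / 3) :=
    fun ξ hξ => mem_closedBall.2 (dist_lt_of_wavePacket_ne_zero v hδ b hξ).le
  refine ⟨?_, HasCompactSupport.of_support_subset_isCompact (isCompact_closedBall _ _) hsub,
    (closure_minimal hsub isClosed_closedBall).trans hΩ⟩
  unfold wavePacket
  refine ContDiff.mul ?_ (Complex.ofRealCLM.contDiff.comp (capBump v δ hδ).contDiff)
  refine ContDiff.cexp (contDiff_const.mul (Complex.ofRealCLM.contDiff.comp ?_))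
  refine (ContDiff.sum fun i _ => contDiff_const.mul ?_).neg
  exact (EuclideanSpace.proj (𝕜 := ℝ) i).contDiff

/-- The extension of a wave packet has the largest possible size, `δ ^ n` up to a constant, on the
whole plank dual to its cap. -/
theorem le_norm_extensionOp_wavePacket {κ : ℝ} (hκ : IsPlankConstant F κ)
    {Ω : Set (EuclideanSpace ℝ (Fin n))}
    (hΩ : closedBall (WithLp.toLp 2 v) (δ / 3) ⊆ Ω)
    {z : (Fin k → ℝ) × (Fin n → ℝ)} (ht : ‖z.1‖ ≤ κ / δ ^ 2)
    (hy : ‖z.2 - (b - gradBilin F z.1 v)‖ ≤ κ / δ) :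
    (1 / 2) * ((1 / 4) ^ n * volume.real (ball (0 : EuclideanSpace ℝ (Fin n)) 1)) * δ ^ n
      ≤ ‖extensionOp F Ω (wavePacket v δ hδ b) (splitPoint z)‖ := by
  set φ := capBump v δ hδ with hφ
  have hφint : Integrable (fun ξ => φ ξ) volume :=
    φ.continuous.integrable_of_hasCompactSupport φ.hasCompactSupport
  have hlow : ((1 / 4) ^ n * volume.real (ball (0 : EuclideanSpace ℝ (Fin n)) 1)) * δ ^ n
      ≤ ∫ ξ in Ω, φ ξ := by
    have hball : volume.real (closedBall (WithLp.toLp 2 v : EuclideanSpace ℝ (Fin n)) (δ / 4))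
        = ((1 / 4) ^ n * volume.real (ball (0 : EuclideanSpace ℝ (Fin n)) 1)) * δ ^ n := by
      rw [Measure.addHaar_real_closedBall _ _ (by positivity), finrank_euclideanSpace,
        Fintype.card_fin, div_pow, div_pow, one_pow]
      ring
    have hsub : closedBall (WithLp.toLp 2 v : EuclideanSpace ℝ (Fin n)) (δ / 4) ⊆ Ω :=
      (closedBall_subset_closedBall (by linarith)).trans hΩ
    rw [← hball]
    calc _ = ∫ ξ in closedBall (WithLp.toLp 2 v : EuclideanSpace ℝ (Fin n)) (δ / 4), (1 : ℝ) := by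
          simp
      _ = ∫ ξ in closedBall (WithLp.toLp 2 v : EuclideanSpace ℝ (Fin n)) (δ / 4), φ ξ :=
          setIntegral_congr_fun measurableSet_closedBall fun ξ hξ =>
            (φ.one_of_mem_closedBall hξ).symm
      _ ≤ ∫ ξ in Ω, φ ξ :=
          setIntegral_mono_set hφint.integrableOn
            (Filter.Eventually.of_forall fun ξ => φ.nonneg) hsub.eventuallyLE
  have hmain := half_integral_le_norm_integral_exp (μ := volume.restrict Ω)
    (θ := fun ξ => ∑ i, (z.2 i - b i) * ξ i + ∑ j, z.1 j * F j ξ) (φ := fun ξ => φ ξ)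
    (by
      have := fun j => continuous_quadraticForm (F j)
      exact Continuous.measurable (by fun_prop))
    hφint.restrict (fun ξ => φ.nonneg)
    (∑ i, (z.2 i - b i) * v i + ∑ j, z.1 j * F j (WithLp.toLp 2 v))
    (fun ξ hξ => by
      refine hκ δ hδ z.1 z.2 b v ξ ht hy ?_
      by_contra! hcon
      refine hξ (φ.zero_of_le_dist ?_)
      rw [dist_eq_norm]
      exact le_trans (show δ / 3 ≤ δ by linarith) hcon.le)
  rw [mul_assoc]
  refine (mul_le_mul_of_nonneg_left hlow (by norm_num)).trans (hmain.trans (le_of_eq ?_))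
  rw [extensionOp]
  congr 2
  ext ξ
  rw [wavePacket, inner_splitPoint_graphMap, ← mul_assoc, ← Complex.exp_add]
  congr 2
  rw [← mul_add, ← Complex.ofReal_add]
  congr 2
  simp only [sub_mul, Finset.sum_sub_distrib]
  ring

end

/-- Shearing a box by a function of `t` does not change its volume. -/
theorem volume_setOf_plank {n k : ℕ} {m : (Fin k → ℝ) → Fin n → ℝ} (hm : Continuous m) {R r : ℝ}
    (hR : 0 ≤ R) (hr : 0 ≤ r) :
    volume {z : (Fin k → ℝ) × (Fin n → ℝ) | ‖z.1‖ ≤ R ∧ ‖z.2 - m z.1‖ ≤ r}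
      = ENNReal.ofReal ((2 * R) ^ k * (2 * r) ^ n) := by
  have hmeas : MeasurableSet {z : (Fin k → ℝ) × (Fin n → ℝ) | ‖z.1‖ ≤ R ∧ ‖z.2 - m z.1‖ ≤ r} := by
    refine IsClosed.measurableSet (IsClosed.and (isClosed_le ?_ ?_) (isClosed_le ?_ ?_)) <;> fun_prop
  rw [Measure.volume_eq_prod, Measure.prod_apply hmeas]
  have hsec : ∀ t : Fin k → ℝ, volume (Prod.mk t ⁻¹'
      {z : (Fin k → ℝ) × (Fin n → ℝ) | ‖z.1‖ ≤ R ∧ ‖z.2 - m z.1‖ ≤ r})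
      = (closedBall (0 : Fin k → ℝ) R).indicator (fun _ => ENNReal.ofReal ((2 * r) ^ n)) t := by
    intro t
    by_cases ht : ‖t‖ ≤ R
    · rw [Set.indicator_of_mem (mem_closedBall_zero_iff.2 ht)]
      have : Prod.mk t ⁻¹' {z : (Fin k → ℝ) × (Fin n → ℝ) | ‖z.1‖ ≤ R ∧ ‖z.2 - m z.1‖ ≤ r}
          = closedBall (m t) r := by
        ext y; simp [ht, dist_eq_norm]
      rw [this, Real.volume_pi_closedBall _ hr, Fintype.card_fin]
    · rw [Set.indicator_of_notMem (fun h => ht (mem_closedBall_zero_iff.1 h))]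
      simp [ht]
  simp only [hsec]
  rw [lintegral_indicator measurableSet_closedBall, setLIntegral_const,
    Real.volume_pi_closedBall _ hR, Fintype.card_fin, ← ENNReal.ofReal_mul (by positivity), mul_comm]

theorem volume_le_of_section_le {n k : ℕ} {E : Set ((Fin k → ℝ) × (Fin n → ℝ))}
    (hE : MeasurableSet E) {R : ℝ} (hR : 0 ≤ R) (hER : ∀ z ∈ E, ‖z.1‖ ≤ R) {V : ℝ≥0∞}
    (hV : ∀ t, ‖t‖ ≤ R → volume (Prod.mk t ⁻¹' E) ≤ V) :
    volume E ≤ V * ENNReal.ofReal ((2 * R) ^ k) := by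
  rw [Measure.volume_eq_prod, Measure.prod_apply hE]
  calc _ ≤ ∫⁻ t, (closedBall (0 : Fin k → ℝ) R).indicator (fun _ => V) t := by
        refine lintegral_mono fun t => ?_
        by_cases ht : ‖t‖ ≤ R
        · rw [Set.indicator_of_mem (mem_closedBall_zero_iff.2 ht)]
          exact hV t ht
        · have : Prod.mk t ⁻¹' E = ∅ :=
            Set.eq_empty_of_forall_notMem fun y hy => ht (hER _ hy)
          simp [this]
    _ = _ := by
        rw [lintegral_indicator measurableSet_closedBall, setLIntegral_const,
          Real.volume_pi_closedBall _ hR, Fintype.card_fin]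

/-! ### Failure of the endpoint estimate -/

/-- Wave packets at `δ`-separated frequencies have disjoint supports. -/
theorem norm_sum_wavePacket_le {n : ℕ} {ι : Type*} [Fintype ι] {v : ι → Fin n → ℝ} {δ : ℝ}
    (hδ : 0 < δ) (b : ι → Fin n → ℝ)
    (hv : ∀ i j, i ≠ j →
      δ ≤ dist (WithLp.toLp 2 (v i) : EuclideanSpace ℝ (Fin n)) (WithLp.toLp 2 (v j)))
    {σ : ι → ℝ} (hσ : ∀ j, |σ j| = 1) (ξ : EuclideanSpace ℝ (Fin n)) :
    ‖∑ j, (σ j : ℂ) * wavePacket (v j) δ hδ (b j) ξ‖ ≤ 1 := by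
  by_cases h : ∃ j, wavePacket (v j) δ hδ (b j) ξ ≠ 0
  · obtain ⟨j, hj⟩ := h
    rw [Finset.sum_eq_single j]
    · rw [norm_mul, Complex.norm_real, Real.norm_eq_abs, hσ, one_mul]
      exact norm_wavePacket_le _ _ _ _
    · intro i _ hij
      by_contra hne
      have hi := dist_lt_of_wavePacket_ne_zero _ _ _ (right_ne_zero_of_mul hne)
      have hj := dist_lt_of_wavePacket_ne_zero _ _ _ hj
      have := dist_triangle_left (WithLp.toLp 2 (v i) : EuclideanSpace ℝ (Fin n))
        (WithLp.toLp 2 (v j)) ξ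
      linarith [hv i j hij]
    · simp
  · push Not at h
    simp [h]

/-- The planks dual to the caps at the grid points `c + s ν / N`, positioned by the translations `a`,
have a union with small section at `t`, provided that `a` compresses the grid at the rescaled
parameter `δ ^ 2 • t`. -/
theorem volume_section_planks_le {n k N : ℕ} (hN : 1 ≤ N)
    (A : (Fin k → ℝ) →L[ℝ] (Fin n → ℝ) →L[ℝ] (Fin n → ℝ)) {κ ε s δ : ℝ} (hs : 0 < s)
    (hδ : δ = s / N) (c : Fin n → ℝ) {a : (Fin n → ℕ) → Fin n → ℝ} {t : Fin k → ℝ}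
    (ha : ∃ (P : Finset (Fin n → ℝ)) (ρ : ℝ), 0 ≤ ρ ∧ P.card * (2 * ρ) ^ n ≤ ε ∧
        ∀ ν : Fin n → ℕ, (∀ i, ν i < N) →
          ∃ p ∈ P, ‖a ν - A (δ ^ 2 • t) (fun i => (ν i : ℝ) / N) - p‖ + κ / N ≤ ρ) :
    volume (⋃ ν : Fin n → Fin N, {y : Fin n → ℝ |
        ‖y - ((s / δ ^ 2) • a (fun i => ν i) - A t (fun i => c i + s * ((ν i : ℕ) / N)))‖ ≤ κ / δ})
      ≤ ENNReal.ofReal ((s / δ ^ 2) ^ n * ε) := by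
  obtain ⟨P, ρ, hρ, hP, hcov⟩ := ha
  have hN0 : (0 : ℝ) < N := by exact_mod_cast hN
  have hδ0 : 0 < δ := by rw [hδ]; positivity
  set lam := s / δ ^ 2 with hlam
  have hlam0 : 0 < lam := by positivity
  have hsub : (⋃ ν : Fin n → Fin N, {y : Fin n → ℝ |
        ‖y - (lam • a (fun i => ν i) - A t (fun i => c i + s * ((ν i : ℕ) / N)))‖ ≤ κ / δ})
      ⊆ ⋃ p ∈ P, closedBall (lam • p - A t c) (lam * ρ) := by
    intro y hy
    obtain ⟨ν, hν⟩ := Set.mem_iUnion.1 hy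
    obtain ⟨p, hp, hpν⟩ := hcov (fun i => ν i) fun i => (ν i).2
    refine Set.mem_iUnion₂.2 ⟨p, hp, ?_⟩
    rw [mem_closedBall, dist_eq_norm]
    have hlin : A t (fun i => c i + s * ((ν i : ℕ) / N))
        = A t c + lam • A (δ ^ 2 • t) (fun i => ((ν i : ℕ) : ℝ) / N) := by
      have h1 : (fun i => c i + s * (((ν i : ℕ) : ℝ) / N))
          = c + s • fun i => ((ν i : ℕ) : ℝ) / N := by
        ext i; simp
      rw [h1, map_add, map_smul, map_smul, smul_apply, smul_smul]
      congr 2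
      rw [hlam]; field_simp
    have hsplit : y - (lam • p - A t c)
        = (y - (lam • a (fun i => ν i) - A t (fun i => c i + s * ((ν i : ℕ) / N))))
          + lam • (a (fun i => ν i) - A (δ ^ 2 • t) (fun i => ((ν i : ℕ) : ℝ) / N) - p) := by
      rw [hlin, smul_sub, smul_sub]; abel
    have hκδ : κ / δ = lam * (κ / N) := by
      have : (N : ℝ) = s / δ := by rw [hδ]; field_simp
      rw [this, hlam]; field_simp
    rw [hsplit]
    refine (norm_add_le _ _).trans ?_
    rw [norm_smul, Real.norm_of_nonneg hlam0.le]
    have h2 : ‖y - (lam • a (fun i => ν i) - A t (fun i => c i + s * ((ν i : ℕ) / N)))‖ ≤ κ / δ := hν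
    have h3 := mul_le_mul_of_nonneg_left hpν hlam0.le
    rw [mul_add] at h3
    linarith
  refine (measure_mono hsub).trans ((measure_biUnion_finset_le _ _).trans ?_)
  have hball : ∀ p ∈ P, volume (closedBall (lam • p - A t c) (lam * ρ))
      = ENNReal.ofReal ((2 * (lam * ρ)) ^ n) := fun p _ => by
    rw [Real.volume_pi_closedBall _ (by positivity), Fintype.card_fin]
  rw [Finset.sum_congr rfl hball, Finset.sum_const, nsmul_eq_mul, ← ENNReal.ofReal_natCast,
    ← ENNReal.ofReal_mul (by positivity)]
  refine ENNReal.ofReal_le_ofReal ?_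
  calc _ = lam ^ n * (P.card * (2 * ρ) ^ n) := by rw [mul_left_comm, mul_pow lam]; ring
    _ ≤ _ := by gcongr

theorem exists_rpow_le {β D q : ℝ} (hD : 0 < D) (hq : 2 < q) :
    ∃ τ : ℝ, 0 < τ ∧ 2 * (β * (τ ^ (2 - q) / (q - 2))) ≤ D / 4 := by
  have h1 : Filter.Tendsto (fun τ : ℝ => 2 * (β * (τ ^ (2 - q) / (q - 2)))) Filter.atTop
      (nhds (2 * (β * (0 / (q - 2))))) := by
    have := tendsto_rpow_neg_atTop (y := q - 2) (by linarith)
    rw [neg_sub] at this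
    exact ((this.div_const _).const_mul _).const_mul _
  simp only [zero_div, mul_zero] at h1
  obtain ⟨τ, hτ, hτ0⟩ := ((h1.eventually_le_const (show 0 < D / 4 by positivity)).and
    (Filter.eventually_gt_atTop 0)).exists
  exact ⟨τ, hτ0, hτ⟩

theorem norm_le_card_mul {n : ℕ} {w : EuclideanSpace ℝ (Fin n)} {s : ℝ} (hw : ∀ i, |w i| ≤ s) :
    ‖w‖ ≤ n * s := by
  rw [eq_sum_smul_single w]
  refine (norm_sum_le _ _).trans ?_
  calc _ ≤ ∑ _i : Fin n, s := Finset.sum_le_sum fun i _ => by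
        rw [norm_smul, Real.norm_eq_abs]; simpa using hw i
    _ = n * s := by simp

/-- The superposition, with suitable signs, of one wave packet for each cap, positioned so that their
planks compress, violates any weak type estimate with exponent `q = 2 (n + k) / n`. -/
theorem not_hasWeakExtensionEstimate {n k : ℕ} (hn : 1 ≤ n) (hk : 1 ≤ k)
    (F : Fin k → QuadraticForm ℝ (EuclideanSpace ℝ (Fin n)))
    (c : EuclideanSpace ℝ (Fin n)) {r : ℝ} (hr : 0 < r) (p : ℝ≥0∞) :
    ¬ HasWeakExtensionEstimate F (ball c r) p (2 * ((n + k : ℕ) : ℝ) / (n : ℝ)) := by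
  rintro ⟨C, hC⟩
  have hn0 : (0 : ℝ) < n := by exact_mod_cast hn
  have hk0 : (0 : ℝ) < k := by exact_mod_cast hk
  set q : ℝ := 2 * ((n + k : ℕ) : ℝ) / (n : ℝ) with hqdef
  -- At this exponent all estimates below scale as `δ ^ (-2 k)`.
  have hnq : n * (2 - q) = -(2 * k : ℝ) := by
    rw [hqdef]; push_cast; field_simp; ring
  have hq : 2 < q := by
    rw [hqdef, lt_div_iff₀ hn0]; push_cast; linarith
  obtain ⟨κ, hκ0, hκ⟩ := exists_isPlankConstant hn F
  set K : ℝ≥0∞ := C * volume (ball c r) ^ p.toReal⁻¹ with hKdef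
  have hK : K ^ q ≠ ⊤ := by
    refine ENNReal.rpow_ne_top_of_nonneg (by linarith) (ENNReal.mul_ne_top ENNReal.coe_ne_top ?_)
    exact ENNReal.rpow_ne_top_of_nonneg (by positivity) measure_ball_lt_top.ne
  set β : ℝ := (K ^ q).toReal with hβ
  set s : ℝ := r / (n + 1) with hs
  have hs0 : 0 < s := by positivity
  set c₁ : ℝ := (1 / 2) * ((1 / 4) ^ n * volume.real (ball (0 : EuclideanSpace ℝ (Fin n)) 1))
    with hc₁
  have hc₁0 : 0 < c₁ := by
    have : 0 < volume.real (ball (0 : EuclideanSpace ℝ (Fin n)) 1) :=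
      ENNReal.toReal_pos (measure_ball_pos _ _ one_pos).ne' measure_ball_lt_top.ne
    positivity
  set D : ℝ := s ^ n * c₁ ^ 2 * ((2 * κ) ^ k * (2 * κ) ^ n) with hD
  have hD0 : 0 < D := by positivity
  -- The height `τ` makes the tail of the distribution function harmless; the compression `ε`,
  -- chosen afterwards, makes the part of the extension of `f` below that height harmless.
  obtain ⟨τ, hτ0, hτ⟩ := exists_rpow_le (β := β) hD0 hq
  set ε : ℝ := D / (8 * τ ^ 2 * (2 * κ) ^ k * s ^ n) with hε
  obtain ⟨N, hN, a, ha⟩ := exists_compression hn (gradBilin F) hκ0 (ε := ε) (by positivity)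
  have hN0 : (0 : ℝ) < N := by exact_mod_cast hN
  set δ : ℝ := s / N with hδdef
  have hδ : 0 < δ := by positivity
  set b : (Fin n → Fin N) → Fin n → ℝ := fun ν => (s / δ ^ 2) • a (fun i => ν i) with hb
  set v : (Fin n → Fin N) → Fin n → ℝ := fun ν i => c i + s * ((ν i : ℕ) / N) with hv
  set plank : (Fin n → Fin N) → Set ((Fin k → ℝ) × (Fin n → ℝ)) := fun ν =>
    {z | ‖z.1‖ ≤ κ / δ ^ 2 ∧ ‖z.2 - (b ν - gradBilin F z.1 (v ν))‖ ≤ κ / δ} with hplank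
  have hplank_meas : ∀ ν, MeasurableSet (plank ν) := fun ν => by
    refine IsClosed.measurableSet (IsClosed.and (isClosed_le ?_ ?_) (isClosed_le ?_ ?_)) <;> fun_prop
  set E := ⋃ ν, plank ν with hE
  have hE_meas : MeasurableSet E := MeasurableSet.iUnion hplank_meas
  have hE_vol : volume E ≤ ENNReal.ofReal ((s / δ ^ 2) ^ n * ε * (2 * (κ / δ ^ 2)) ^ k) := by
    rw [ENNReal.ofReal_mul (by positivity)]
    refine volume_le_of_section_le hE_meas (by positivity) ?_ fun t ht => ?_
    · intro z hz
      obtain ⟨ν, hν⟩ := Set.mem_iUnion.1 hz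
      exact hν.1
    · have hcomp := ha (δ ^ 2 • t) (by
        rw [norm_smul, Real.norm_of_nonneg (by positivity)]
        rw [le_div_iff₀ (by positivity)] at ht; linarith)
      refine le_trans (measure_mono ?_)
        (volume_section_planks_le hN (gradBilin F) hs0 hδdef (fun i => c i) hcomp)
      intro y hy
      obtain ⟨ν, hν⟩ := Set.mem_iUnion.1 (show (t, y) ∈ E from hy)
      exact Set.mem_iUnion.2 ⟨ν, hν.2⟩
  -- The caps lie in the ball and their centres are `δ`-separated.
  have hcap : ∀ ν, closedBall (WithLp.toLp 2 (v ν)) (δ / 3) ⊆ ball c r := fun ν => by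
    have hδs : δ ≤ s := div_le_self hs0.le (by exact_mod_cast hN)
    refine closedBall_subset_ball' ?_
    have h1 : dist (WithLp.toLp 2 (v ν)) c ≤ n * s := by
      rw [dist_eq_norm]
      refine norm_le_card_mul fun i => ?_
      have h0 : ((ν i : ℕ) : ℝ) / N ≤ 1 := by
        rw [div_le_one hN0]; exact_mod_cast (ν i).2.le
      simp only [hv, PiLp.sub_apply, add_sub_cancel_left]
      rw [abs_of_nonneg (by positivity)]
      exact mul_le_of_le_one_right hs0.le h0
    have h2 : (n + 1) * s = r := by rw [hs]; field_simp
    linarith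
  have hsep : ∀ ν μ, ν ≠ μ →
      δ ≤ dist (WithLp.toLp 2 (v ν) : EuclideanSpace ℝ (Fin n)) (WithLp.toLp 2 (v μ)) := by
    intro ν μ hne
    obtain ⟨i, hi⟩ := Function.ne_iff.1 hne
    have h1 : (1 : ℝ) ≤ |((ν i : ℕ) : ℝ) - ((μ i : ℕ) : ℝ)| := by
      have : ((ν i : ℕ) : ℤ) - ((μ i : ℕ) : ℤ) ≠ 0 := by
        intro h; exact hi (Fin.ext (by omega))
      exact_mod_cast Int.one_le_abs this
    rw [dist_eq_norm]
    refine le_trans ?_ (PiLp.norm_apply_le _ i)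
    have h2 : (WithLp.toLp 2 (v ν) - WithLp.toLp 2 (v μ) : EuclideanSpace ℝ (Fin n)) i
        = δ * (((ν i : ℕ) : ℝ) - ((μ i : ℕ) : ℝ)) := by
      simp only [hv, PiLp.sub_apply, hδdef]; ring
    rw [h2, Real.norm_eq_abs, abs_mul, abs_of_pos hδ]
    exact le_mul_of_one_le_right hδ.le h1
  have htest : ∀ ν, IsTestFunction (ball c r) (wavePacket (v ν) δ hδ (b ν)) :=
    fun ν => isTestFunction_wavePacket _ _ _ (hcap ν)
  set g : (Fin n → Fin N) → (Fin k → ℝ) × (Fin n → ℝ) → ℂ := fun ν z =>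
    extensionOp F (ball c r) (wavePacket (v ν) δ hδ (b ν)) (splitPoint z) with hg
  have hsplit := measurePreserving_splitPoint n k
  have hg_meas : ∀ ν, Measurable (g ν) := fun ν =>
    (measurable_extensionOp F _ (htest ν).smooth.continuous).comp hsplit.measurable
  obtain ⟨σ, hσ, hσle⟩ := exists_signs_sum_lintegral_sq_le (μ := volume.restrict E)
    (fun ν => (hg_meas ν).aemeasurable) Finset.univ
  set f : EuclideanSpace ℝ (Fin n) → ℂ :=
    fun ξ => ∑ ν, (σ ν : ℂ) * wavePacket (v ν) δ hδ (b ν) ξ with hf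
  have hf_test : IsTestFunction (ball c r) f := isTestFunction_sum _ htest σ
  have hf_norm : eLpNorm f p (volume.restrict (ball c r)) ≤ volume (ball c r) ^ p.toReal⁻¹ := by
    refine (eLpNorm_le_of_ae_bound (C := 1) (Filter.Eventually.of_forall fun ξ =>
      norm_sum_wavePacket_le hδ b hsep hσ ξ)).trans ?_
    simp
  have hweak : weakLpNorm (extensionOp F (ball c r) f) q ≤ K :=
    (hC f hf_test).trans (by rw [hKdef]; gcongr)
  have hEf_meas := measurable_extensionOp F (ball c r) hf_test.smooth.continuous
  have hEf : ∀ z, extensionOp F (ball c r) f (splitPoint z) = ∑ ν, (σ ν : ℂ) * g ν z := fun z =>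
    extensionOp_sum F _ _ (fun ν => (htest ν).smooth.continuous) (fun ν => (htest ν).compact) σ _
  have hdist : ∀ t : ℝ, 0 < t → volume {z | t < ‖extensionOp F (ball c r) f (splitPoint z)‖}
      ≤ K ^ q * ENNReal.ofReal (t ^ (-q)) := fun t ht => by
    refine le_trans (le_of_eq ?_) (volume_norm_gt_le (by linarith) hweak ht)
    exact hsplit.measure_preimage
      (measurableSet_lt measurable_const hEf_meas.norm).nullMeasurableSet
  set T : ℝ := τ * δ ^ n with hT
  have hT0 : 0 < T := by positivity
  have hupper := setLIntegral_sq_le_of_distribution volume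
    (h := fun z => ‖extensionOp F (ball c r) f (splitPoint z)‖) (fun _ => norm_nonneg _)
    (hEf_meas.comp hsplit.measurable).norm.aemeasurable hq hdist E hT0
  -- There are `N ^ n` planks, each of volume comparable to `δ ^ (-2 k - n)`.
  have hlower : ENNReal.ofReal (D * (δ ^ (2 * k))⁻¹)
      ≤ ∑ ν, ∫⁻ z in E, ENNReal.ofReal (‖g ν z‖ ^ 2) := by
    have hone : ∀ ν, ENNReal.ofReal ((c₁ * δ ^ n) ^ 2
        * ((2 * (κ / δ ^ 2)) ^ k * (2 * (κ / δ)) ^ n))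
        ≤ ∫⁻ z in E, ENNReal.ofReal (‖g ν z‖ ^ 2) := fun ν => by
      rw [ENNReal.ofReal_mul (by positivity),
        ← volume_setOf_plank (m := fun t => b ν - gradBilin F t (v ν)) (by fun_prop)
          (by positivity) (by positivity)]
      calc _ = ∫⁻ z in plank ν, ENNReal.ofReal ((c₁ * δ ^ n) ^ 2) := by
            rw [setLIntegral_const]
        _ ≤ ∫⁻ z in plank ν, ENNReal.ofReal (‖g ν z‖ ^ 2) := by
            refine setLIntegral_mono' (hplank_meas ν) fun z hz => ?_
            refine ENNReal.ofReal_le_ofReal (pow_le_pow_left₀ (by positivity) ?_ 2)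
            exact le_norm_extensionOp_wavePacket F _ hδ _ hκ (hcap ν) hz.1 hz.2
        _ ≤ _ := lintegral_mono_set (Set.subset_iUnion plank ν)
    refine le_trans (le_of_eq ?_) (Finset.sum_le_sum fun ν _ => hone ν)
    rw [Finset.sum_const, nsmul_eq_mul, ← ENNReal.ofReal_natCast,
      ← ENNReal.ofReal_mul (by positivity)]
    congr 1
    simp only [Finset.card_univ, Fintype.card_pi, Fintype.card_fin, Finset.prod_const,
      Nat.cast_pow]
    have hNδ : (N : ℝ) = s / δ := by rw [hδdef]; field_simp
    rw [hNδ, hD]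
    simp only [mul_pow, div_pow, ← pow_mul]
    field_simp
    ring
  have hTq : T ^ (2 - q) = τ ^ (2 - q) * (δ ^ (2 * k))⁻¹ := by
    rw [hT, Real.mul_rpow hτ0.le (by positivity), ← Real.rpow_natCast δ n, ← Real.rpow_mul hδ.le,
      hnq, Real.rpow_neg hδ.le]
    congr 2
    exact_mod_cast Real.rpow_natCast δ (2 * k)
  have hfinal : ENNReal.ofReal (D * (δ ^ (2 * k))⁻¹)
      ≤ ENNReal.ofReal (D / 2 * (δ ^ (2 * k))⁻¹) := by
    refine hlower.trans (hσle.trans ?_)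
    simp only [← hEf]
    refine hupper.trans ?_
    calc _ ≤ 2 * (ENNReal.ofReal (T ^ 2)
            * ENNReal.ofReal ((s / δ ^ 2) ^ n * ε * (2 * (κ / δ ^ 2)) ^ k)
            + ENNReal.ofReal β * ENNReal.ofReal (T ^ (2 - q) / (q - 2))) := by
          rw [hβ, ENNReal.ofReal_toReal hK]; gcongr
      _ = ENNReal.ofReal (2 * (T ^ 2 * ((s / δ ^ 2) ^ n * ε * (2 * (κ / δ ^ 2)) ^ k)
            + β * (T ^ (2 - q) / (q - 2)))) := by
          have hβ0 : 0 ≤ β := ENNReal.toReal_nonneg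
          have hq0 : 0 < q - 2 := by linarith
          rw [← ENNReal.ofReal_mul (by positivity), ← ENNReal.ofReal_mul hβ0,
            ← ENNReal.ofReal_add (by positivity) (by positivity),
            ENNReal.ofReal_mul zero_le_two]
          simp
      _ ≤ _ := by
          refine ENNReal.ofReal_le_ofReal ?_
          have h1 : 2 * (T ^ 2 * ((s / δ ^ 2) ^ n * ε * (2 * (κ / δ ^ 2)) ^ k))
              = D / 4 * (δ ^ (2 * k))⁻¹ := by
            rw [hT, hε]
            simp only [mul_pow, div_pow, ← pow_mul]
            field_simp
            ring
          have h2 : 2 * (β * (T ^ (2 - q) / (q - 2))) ≤ D / 4 * (δ ^ (2 * k))⁻¹ := by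
            rw [hTq]
            calc _ = 2 * (β * (τ ^ (2 - q) / (q - 2))) * (δ ^ (2 * k))⁻¹ := by ring
              _ ≤ _ := by gcongr
          linarith
  rw [ENNReal.ofReal_le_ofReal_iff (by positivity)] at hfinal
  have : 0 < D * (δ ^ (2 * k))⁻¹ := by positivity
  linarith

theorem ExtendsToBoundedOperator.hasWeakExtensionEstimate {n k : ℕ}
    {F : Fin k → QuadraticForm ℝ (EuclideanSpace ℝ (Fin n))} {Ω : Set (EuclideanSpace ℝ (Fin n))}
    {p : ℝ≥0∞} {q : ℝ} (h : ExtendsToBoundedOperator F Ω p q) :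
    HasWeakExtensionEstimate F Ω p q := by
  obtain ⟨T, ⟨C, hC⟩, hT⟩ := h
  refine ⟨C, fun f hf => ?_⟩
  have hmem : MemLp f p (volume.restrict Ω) :=
    (hf.smooth.continuous.memLp_of_hasCompactSupport hf.compact).restrict Ω
  have hae := hT f hf (hmem.toLp f) hmem.coeFn_toLp
  have hnorm := hC (hmem.toLp f)
  rw [Lp.enorm_toLp] at hnorm
  -- The weak quasinorm depends only on the almost everywhere class.
  refine le_trans (le_of_eq ?_) hnorm
  unfold weakLpNorm
  congr 1; ext t
  congr 2
  refine measure_congr ?_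
  filter_upwards [hae] with x hx
  change (_ < _) = (_ < _)
  rw [hx]

theorem theorem1 (n k : ℕ) (hn : 1 ≤ n) (hk : 1 ≤ k)
    (F : Fin k → QuadraticForm ℝ (EuclideanSpace ℝ (Fin n)))
    (c : EuclideanSpace ℝ (Fin n)) (r : ℝ) (hr : 0 < r) (p : ℝ≥0∞) (hp : 0 < p) :
    ¬ HasWeakExtensionEstimate F (ball c r) p (2 * ((n + k : ℕ) : ℝ) / (n : ℝ)) ∧
      ¬ ExtendsToBoundedOperator F (ball c r) p (2 * ((n + k : ℕ) : ℝ) / (n : ℝ)) :=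
  ⟨not_hasWeakExtensionEstimate hn hk F c hr p,
    fun h => not_hasWeakExtensionEstimate hn hk F c hr p h.hasWeakExtensionEstimate⟩
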